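/- **Conventions.** A digraph $G$ is a set of vertices together with a set of arrows, i.e. ordered pairs of distinct vertices; a subdigraph $A\subseteq G$ consists of a set of vertices of $G$ and a set of arrows of $G$ between them. A digraph map $f:G\to H$ is a map of vertices such that for each arrow $v\to w$ of $G$ either $f(v)\to f(w)$ is an arrow of $H$ or $f(v)=f(w)$. If $C\subseteq A\subseteq G$ and $D\subseteq B\subseteq H$ are subdigraphs, a map of triples $(G,A,C)\to(H,B,D)$ is a digraph map $G\to H$ that restricts to digraph maps $A\to B$ and $C\to D$. The box product $G\,\Box\,H$ has vertex set $V_G\times V_H$, and its arrows are those which are an arrow in one coordinate and constant in the other. The standard line digraph $J_m$ ($m\ge 0$) has vertices $0,\dots,m$ and arrows $i\to i+1$ for even $i$, $i+1\to i$ for odd $i$ $(0\le i<m)$; $\partial J_m$ is the subdigraph with vertices $0,m$ and no arrows. For $n\geq 1$ and $M=(m_1,\dots,m_n)\in\mathbb{Z}_{\ge0}^n$ let $$J_M^{n}=J_{m_1}\Box\cdots\Box J_{m_n},\qquad \partial J_M^{n}=\bigcup_{k=1}^n J_{m_1}\Box\cdots\Box\,\partial J_{m_k}\Box\cdots\Box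 J_{m_n},$$ $$\bar J_M^{n-1}=\{m_1\}\,\Box\, J_{m_2}\Box\cdots\Box J_{m_n}\ \cup\ \bigcup_{k=2}^n J_{m_1}\Box\cdots\Box\,\partial J_{m_k}\Box\cdots\Box J_{m_n}.$$ Let $G$ be a digraph, $A\subseteq G$ a subdigraph and $x_0$ a vertex of $A$. A *triple grid map* is a map of triples $f:(J_M^{n},\partial J_M^{n},\bar J_M^{n-1})\to(G,A,x_0)$ for some $M$. For $M\le S$ (coordinatewise) it extends to a triple grid map on $J_S^{n}$ by the value $f(m_1,\dots,m_n)=x_0$ outside of $J_M^{n}$; triple grid maps that agree after extension to a common larger grid are identified. A *shrinking map* $J_K^n\to J_M^n$ is a product $h_1\Box\cdots\Box h_n$ of order-preserving digraph maps $h_i:J_{k_i}\to J_{m_i}$ with $h_i(0)=0$ and $h_i(k_i)=m_i$; a *subdivision* of $f$ is a composite of $f$ with a shrinking map. Two triple grid maps $f,g$ on the same grid $J_K^n$ are *directly homotopic*, $f\rightrightarrows g$, if there is a map of triples $$F:(J_K^{n}\Box J_1,\ \partial J_K^{n}\Box J_1,\ \bar J_K^{n-1}\Box J_1)\to(G,A,x_0)$$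 with $F(\cdot,0)=f$ and $F(\cdot,1)=g$. Triple grid maps $f,g$ are *one-step $F$-homotopic* if they have subdivisions $\bar f,\bar g$ on a common grid with $\bar f\rightrightarrows\bar g$; *$F$-homotopy* is the equivalence relation generated by one-step $F$-homotopy. Let $\bar\pi_n(G,A)$ be the set of $F$-homotopy classes $[f]$ of triple grid maps (after the above identification). For $2\le j\le n$ and triple grid maps $f$ on $J_M^n$ and $g$ on $J_L^n$, extend $f$ and $g$ by $x_0$ outside of their grids, and let the *concatenation* $\mu^j(f,g)$ be the triple grid map on the grid with $j$-th length $m_j+l_j+1$ and $k$-th length $\max(m_k,l_k)$ for $k\ne j$ given by $$\mu^j(f,g)(i_1,\dots,i_n)=\begin{cases} f(i_1,\dots,i_n), & i_j\le m_j,\\ g(i_1,\dots,i_j-e,\dots,i_n), & i_j>m_j,\end{cases}$$ where $e=m_j$ if $m_j$ is even and $e=m_j+1$ if $m_j$ is odd. **Theorem.** Let $G$ be a digraph, $A$ a subdigraph of $G$, $x_0$ a vertex of $A$, and $n\ge 2$. Then $\bar\pi_n(G,A)$ is a group under concatenation: there is a group structure on $\bar\pi_n(G,A)$ such that $[f]\cdot[g]=[\mu^j(f,g)]$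 for all triple grid maps $f,g$ and every coordinate $2\le j\le n$. If $n\ge3$, this group is abelian. -/

import Mathlib

/-! ### Digraphs, subdigraphs, digraph maps, triples

Digraphs are Mathlib's `Digraph V` (vertex type `V`, arrow relation `Adj`).  Loops play no role
below, since a digraph map may collapse arrows. -/

namespace DigraphHomotopy

universe u v

/-- A subdigraph of `G`: a set of vertices and a set of arrows of `G` between them (it need not be
an induced subdigraph). -/
structure Subdigraph {V : Type u} (G : Digraph V) where
  verts : Set V
  Adj : V → V → Prop
  adj_sub : ∀ {a b : V}, Adj a b → G.Adj a b
  left_mem : ∀ {a b : V}, Adj a b → a ∈ verts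
  right_mem : ∀ {a b : V}, Adj a b → b ∈ verts

/-- A digraph map sends every arrow to an arrow or collapses it to a vertex. -/
def IsDigraphMap {V : Type u} {W : Type v} (G : Digraph V) (H : Digraph W) (f : V → W) : Prop :=
  ∀ a b, G.Adj a b → H.Adj (f a) (f b) ∨ f a = f b

namespace Subdigraph

/-- `f(A) ⊆ B` for subdigraphs: vertices of `A` go to vertices of `B`, and arrows of `A` go to
arrows of `B` or are collapsed. -/
def MapsInto {V : Type u} {W : Type v} {G : Digraph V} {H : Digraph W}
    (A : Subdigraph G) (B : Subdigraph H) (f : V → W) : Prop :=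
  (∀ a ∈ A.verts, f a ∈ B.verts) ∧ ∀ a b, A.Adj a b → B.Adj (f a) (f b) ∨ f a = f b

/-- The one-vertex subdigraph without arrows. -/
def vertex {V : Type u} (G : Digraph V) (x : V) : Subdigraph G where
  verts := {x}
  Adj _ _ := False
  adj_sub h := h.elim
  left_mem h := h.elim
  right_mem h := h.elim

end Subdigraph

/-- A map of digraph triples `(G, A, C) → (H, B, D)`. -/
structure IsTripleMap {V : Type u} {W : Type v} {G : Digraph V} {H : Digraph W}
    (A C : Subdigraph G) (B D : Subdigraph H) (f : V → W) : Prop where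
  isDigraphMap : IsDigraphMap G H f
  mapsInto_fst : A.MapsInto B f
  mapsInto_snd : C.MapsInto D f

/-! ### Box products -/

/-- The box product `G □ H` of two digraphs. -/
def boxProd {V : Type u} {W : Type v} (G : Digraph V) (H : Digraph W) : Digraph (V × W) where
  Adj p q := (p.1 = q.1 ∧ H.Adj p.2 q.2) ∨ (G.Adj p.1 q.1 ∧ p.2 = q.2)

/-- The subdigraph `A □ H` of `G □ H`. -/
def Subdigraph.cylinder {V : Type u} {W : Type v} {G : Digraph V} (A : Subdigraph G)
    (H : Digraph W) : Subdigraph (boxProd G H) where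
  verts := {p | p.1 ∈ A.verts}
  Adj p q := (p.1 = q.1 ∧ p.1 ∈ A.verts ∧ H.Adj p.2 q.2) ∨ (A.Adj p.1 q.1 ∧ p.2 = q.2)
  adj_sub h := h.imp (fun h => ⟨h.1, h.2.2⟩) (fun h => ⟨A.adj_sub h.1, h.2⟩)
  left_mem h := h.elim (fun h => h.2.1) (fun h => A.left_mem h.1)
  right_mem h := h.elim (fun h => Set.mem_ofPred.2 (h.1 ▸ h.2.1)) (fun h => A.right_mem h.1)

/-- The box product of finitely many digraphs: an arrow moves exactly one coordinate, along an
arrow of the corresponding factor. -/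
def boxPi {n : ℕ} {V : Fin n → Type u} (G : ∀ i, Digraph (V i)) : Digraph (∀ i, V i) where
  Adj x y := ∃ i, (∀ l, l ≠ i → x l = y l) ∧ (G i).Adj (x i) (y i)

/-- The subdigraph `⋃ₖ G₁ □ ⋯ □ Bₖ □ ⋯ □ Gₙ` of `G₁ □ ⋯ □ Gₙ`, that is, the subdigraph belonging
to the relative box product of the pairs `(Gₖ, Bₖ)`.  In the union member with index `k`, an arrow
in direction `k` is an arrow of `Bₖ`, and an arrow in a direction `i ≠ k` is an arrow of `Gᵢ`
over a vertex of `Bₖ`. -/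
def relBox {n : ℕ} {V : Fin n → Type u} {G : ∀ i, Digraph (V i)} (B : ∀ i, Subdigraph (G i)) :
    Subdigraph (boxPi G) where
  verts := {x | ∃ k, x k ∈ (B k).verts}
  Adj x y := ∃ k i, (∀ l, l ≠ i → x l = y l) ∧
    ((i = k ∧ (B i).Adj (x i) (y i)) ∨ (i ≠ k ∧ x k ∈ (B k).verts ∧ (G i).Adj (x i) (y i)))
  adj_sub := by
    rintro x y ⟨k, i, h, h' | h'⟩
    · exact ⟨i, h, (B i).adj_sub h'.2⟩
    · exact ⟨i, h, h'.2.2⟩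
  left_mem := by
    rintro x y ⟨k, i, h, h' | h'⟩
    · exact ⟨i, (B i).left_mem h'.2⟩
    · exact ⟨k, h'.2.1⟩
  right_mem := by
    rintro x y ⟨k, i, h, h' | h'⟩
    · exact ⟨i, (B i).right_mem h'.2⟩
    · exact ⟨k, h k (Ne.symm h'.1) ▸ h'.2.1⟩

/-! ### Standard line digraphs and grids -/

/-- The arrows of the standard zig-zag `0 → 1 ← 2 → 3 ← ⋯`. -/
def StdStep (a b : ℕ) : Prop := (Even a ∧ a + 1 = b) ∨ (Odd b ∧ b + 1 = a)

/-- The standard line digraph `J_m` with vertices `0, …, m`. -/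
def stdLine (m : ℕ) : Digraph (Fin (m + 1)) where
  Adj a b := StdStep a b

/-- The boundary `∂J_m`: the vertices `0` and `m`, no arrows. -/
def lineBoundary (m : ℕ) : Subdigraph (stdLine m) where
  verts := {0, Fin.last m}
  Adj _ _ := False
  adj_sub h := h.elim
  left_mem h := h.elim
  right_mem h := h.elim

/-- The vertices of the grid `J_{M₁} □ ⋯ □ J_{Mₙ}`. -/
abbrev GridVertex {n : ℕ} (M : Fin n → ℕ) : Type := ∀ i, Fin (M i + 1)

/-- The grid `J_M^{□n} = J_{M₁} □ ⋯ □ J_{Mₙ}`. -/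
def grid {n : ℕ} (M : Fin n → ℕ) : Digraph (GridVertex M) := boxPi fun i => stdLine (M i)

/-- The boundary `∂J_M^{□n}` of the grid. -/
def gridBoundary {n : ℕ} (M : Fin n → ℕ) : Subdigraph (grid M) :=
  relBox fun i => lineBoundary (M i)

/-- The subdigraph `J̄_M^{□(n-1)} = (M₁ □ J^{□(n-1)}) ∪ (J □ ∂J^{□(n-1)})`, the boundary of the grid
without the open face on which the first coordinate is `0`. -/
def gridCap {n : ℕ} (M : Fin n → ℕ) : Subdigraph (grid M) :=
  relBox fun i =>
    if (i : ℕ) = 0 then Subdigraph.vertex (stdLine (M i)) (Fin.last (M i)) else lineBoundary (M i)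

/-! ### Triple grid maps, homotopies -/

/-- Triple grid maps `(J_M^{□n}, ∂J_M^{□n}, J̄_M^{□(n-1)}) → (G, A, x₀)`. -/
structure TripleGridMap {V : Type u} {G : Digraph V} (A : Subdigraph G) (x₀ : V) {n : ℕ}
    (M : Fin n → ℕ) where
  toFun : GridVertex M → V
  isTripleMap : IsTripleMap (gridBoundary M) (gridCap M) A (Subdigraph.vertex G x₀) toFun

/-- Shrinking maps `J_a → J_b`: monotone digraph maps preserving first and last vertices. -/
structure IsShrinking {a b : ℕ} (h : Fin (a + 1) → Fin (b + 1)) : Prop where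
  isDigraphMap : IsDigraphMap (stdLine a) (stdLine b) h
  map_zero : h 0 = 0
  map_last : h (Fin.last a) = Fin.last b
  monotone : Monotone h

section Maps

variable {V : Type u} {G : Digraph V} {A : Subdigraph G} {x₀ : V} {n : ℕ}

/-- `f'` is a subdivision of `f`: it is `f` composed with a box product of shrinking maps. -/
def IsSubdivision {K M : Fin n → ℕ} (f' : TripleGridMap A x₀ K) (f : TripleGridMap A x₀ M) :
    Prop :=
  ∃ h : ∀ i, Fin (K i + 1) → Fin (M i + 1),
    (∀ i, IsShrinking (h i)) ∧ ∀ x, f'.toFun x = f.toFun fun i => h i (x i)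

/-- Direct homotopy `f ⇉ g` of triple grid maps: a map of triples
`(J_M^{□n}, ∂J_M^{□n}, J̄_M^{□(n-1)}) □ J_1 → (G, A, x₀)` from `f` to `g`. -/
def DirectHomotopic {M : Fin n → ℕ} (f g : TripleGridMap A x₀ M) : Prop :=
  ∃ F : GridVertex M × Fin (1 + 1) → V,
    IsTripleMap ((gridBoundary M).cylinder (stdLine 1)) ((gridCap M).cylinder (stdLine 1))
      A (Subdigraph.vertex G x₀) F ∧
    (∀ x, F (x, 0) = f.toFun x) ∧ ∀ x, F (x, 1) = g.toFun x

/-- One-step `F`-homotopy rel `A`: some subdivisions are directly homotopic. -/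
def OneStep {M L : Fin n → ℕ} (f : TripleGridMap A x₀ M) (g : TripleGridMap A x₀ L) : Prop :=
  ∃ (K : Fin n → ℕ) (f' g' : TripleGridMap A x₀ K),
    IsSubdivision f' f ∧ IsSubdivision g' g ∧ DirectHomotopic f' g'

/-! ### Extending grid maps -/

/-- Extension of a grid map to all of `ℕⁿ`, with value `f(M₁, …, Mₙ)` outside of the grid (this
value is `x₀`, see `TripleGridMap.apply_last`). -/
def TripleGridMap.pad {M : Fin n → ℕ} (f : TripleGridMap A x₀ M) (x : Fin n → ℕ) : V :=
  if h : ∀ k, x k ≤ M k then f.toFun fun k => ⟨x k, Nat.lt_succ_of_le (h k)⟩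
  else f.toFun fun k => Fin.last (M k)

theorem TripleGridMap.eq_base {M : Fin n → ℕ} (f : TripleGridMap A x₀ M) (x : GridVertex M)
    (k : Fin n) (h : ((k : ℕ) ≠ 0 ∧ x k = 0) ∨ x k = Fin.last (M k)) : f.toFun x = x₀ := by
  refine f.isTripleMap.mapsInto_snd.1 x ⟨k, ?_⟩
  by_cases hk : (k : ℕ) = 0
  · simp only [hk, if_true]
    exact h.resolve_left fun h => h.1 hk
  · simp only [hk, if_false]
    rcases h with h | h
    · exact Or.inl h.2
    · exact Or.inr h

theorem TripleGridMap.apply_last {M : Fin n → ℕ} (f : TripleGridMap A x₀ M) (k : Fin n) :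
    (f.toFun fun k => Fin.last (M k)) = x₀ :=
  f.eq_base _ k (Or.inr rfl)

/-- The properties of an extension to `ℕⁿ` of a triple grid map on `J_N^{□n}`; used only to
construct triple grid maps. -/
structure IsPadded (A : Subdigraph G) (x₀ : V) (N : Fin n → ℕ) (φ : (Fin n → ℕ) → V) :
    Prop where
  base_mem : Fin n → x₀ ∈ A.verts
  step : ∀ (x y : Fin n → ℕ) (i : Fin n), (∀ l, l ≠ i → x l = y l) → StdStep (x i) (y i) →
    G.Adj (φ x) (φ y) ∨ φ x = φ y
  face : ∀ (x : Fin n → ℕ) (k : Fin n), (k : ℕ) = 0 → x k = 0 → φ x ∈ A.verts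
  face_step : ∀ (x y : Fin n → ℕ) (i k : Fin n), (k : ℕ) = 0 → x k = 0 → i ≠ k → (∀ l, l ≠ i → x l = y l) →
    StdStep (x i) (y i) → A.Adj (φ x) (φ y) ∨ φ x = φ y
  base_zero : ∀ (x : Fin n → ℕ) (k : Fin n), (k : ℕ) ≠ 0 → x k = 0 → φ x = x₀
  base_last : ∀ (x : Fin n → ℕ) (k : Fin n), N k ≤ x k → φ x = x₀

theorem IsPadded.isTripleMap {N : Fin n → ℕ} {φ : (Fin n → ℕ) → V} (h : IsPadded A x₀ N φ) :
    IsTripleMap (gridBoundary N) (gridCap N) A (Subdigraph.vertex G x₀)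
      (fun x : GridVertex N => φ fun k => x k) := by
  have hcap : ∀ (x : GridVertex N) (k : Fin n), (x k ∈ (if (k : ℕ) = 0 then
      Subdigraph.vertex (stdLine (N k)) (Fin.last (N k)) else lineBoundary (N k)).verts) →
      (φ fun k => x k) = x₀ := by
    intro x k hx
    by_cases hk : (k : ℕ) = 0
    · rw [if_pos hk] at hx
      exact h.base_last _ k (by rw [show x k = Fin.last (N k) from hx]; simp)
    · rw [if_neg hk] at hx
      rcases hx with hx | hx
      · exact h.base_zero _ k hk (by simp [hx])
      · exact h.base_last _ k (by rw [show x k = Fin.last (N k) from hx]; simp)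
  have hbd : ∀ (x : GridVertex N) (k : Fin n), x k ∈ (lineBoundary (N k)).verts →
      ((k : ℕ) = 0 ∧ (x k : ℕ) = 0) ∨ (φ fun k => x k) = x₀ := by
    intro x k hx
    by_cases hk : (k : ℕ) = 0
    · rcases hx with hx | hx
      · exact Or.inl ⟨hk, by simp [hx]⟩
      · exact Or.inr (h.base_last _ k (by rw [show x k = Fin.last (N k) from hx]; simp))
    · exact Or.inr (hcap x k (by rw [if_neg hk]; exact hx))
  have coe : ∀ {x y : GridVertex N} {i : Fin n}, (∀ l, l ≠ i → x l = y l) →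
      ∀ l, l ≠ i → ((x l : ℕ)) = y l := fun hxy l hl => by rw [hxy l hl]
  refine ⟨?_, ⟨?_, ?_⟩, ⟨?_, ?_⟩⟩
  · rintro x y ⟨i, hxy, hs⟩
    exact h.step _ _ i (coe hxy) hs
  · rintro x ⟨k, hx⟩
    rcases hbd x k hx with hk | hk
    · exact h.face _ k hk.1 hk.2
    · simp only [hk]; exact h.base_mem k
  · rintro x y ⟨k, i, hxy, hs | hs⟩
    · exact hs.2.elim
    · rcases hbd x k hs.2.1 with hk | hk
      · exact h.face_step _ _ i k hk.1 hk.2 hs.1 (coe hxy) hs.2.2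
      · have hy : y k ∈ (lineBoundary (N k)).verts := hxy k (Ne.symm hs.1) ▸ hs.2.1
        rcases hbd y k hy with hk' | hk'
        · exact h.face_step _ _ i k hk'.1 (by rw [hxy k (Ne.symm hs.1)]; exact hk'.2) hs.1
            (coe hxy) hs.2.2
        · exact Or.inr (hk.trans hk'.symm)
  · rintro x ⟨k, hx⟩
    exact hcap x k hx
  · rintro x y hxy
    obtain ⟨k, hx⟩ := (gridCap N).left_mem hxy
    obtain ⟨k', hy⟩ := (gridCap N).right_mem hxy
    exact Or.inr ((hcap x k hx).trans (hcap y k' hy).symm)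

theorem TripleGridMap.pad_isPadded {M : Fin n → ℕ} (f : TripleGridMap A x₀ M) :
    IsPadded A x₀ M f.pad := by
  have hmem : Fin n → x₀ ∈ A.verts := fun k => by
    rw [← f.apply_last k]
    exact f.isTripleMap.mapsInto_fst.1 _ ⟨k, Or.inr rfl⟩
  have hin : ∀ x (h : ∀ k, x k ≤ M k),
      f.pad x = f.toFun fun k => ⟨x k, Nat.lt_succ_of_le (h k)⟩ := fun x h => dif_pos h
  have hlast : ∀ x k, M k ≤ x k → f.pad x = x₀ := by
    intro x k hk
    by_cases h : ∀ k, x k ≤ M k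
    · rw [hin x h]
      exact f.eq_base _ k (Or.inr (Fin.ext (le_antisymm (h k) hk)))
    · rw [TripleGridMap.pad, dif_neg h, f.apply_last k]
  have hor : ∀ x : Fin n → ℕ, (∀ k, x k ≤ M k) ∨ ∃ k, M k < x k := fun x => by
    by_cases h : ∀ k, x k ≤ M k
    · exact Or.inl h
    · push Not at h; exact Or.inr h
  have hcross : ∀ (x y : Fin n → ℕ) i, (∀ l, l ≠ i → x l = y l) → StdStep (x i) (y i) →
      ((∀ k, x k ≤ M k) ∧ ∀ k, y k ≤ M k) ∨ f.pad x = f.pad y := by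
    intro x y i hxy hs
    have key : ∀ k, M k < x k ∨ M k < y k → M k ≤ x k ∧ M k ≤ y k := by
      intro k hk
      by_cases hki : k = i
      · subst hki
        rcases hs with hs | hs <;> omega
      · have := hxy k hki
        omega
    rcases hor x with hx | ⟨k, hk⟩
    · rcases hor y with hy | ⟨k, hk⟩
      · exact Or.inl ⟨hx, hy⟩
      · have := key k (Or.inr hk)
        exact Or.inr ((hlast x k this.1).trans (hlast y k this.2).symm)
    · have := key k (Or.inl hk)
      exact Or.inr ((hlast x k this.1).trans (hlast y k this.2).symm)
  refine ⟨hmem, ?_, ?_, ?_, ?_, hlast⟩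
  · intro x y i hxy hs
    rcases hcross x y i hxy hs with ⟨hx, hy⟩ | h
    · rw [hin x hx, hin y hy]
      exact f.isTripleMap.isDigraphMap _ _ ⟨i, fun l hl => Fin.ext (hxy l hl), hs⟩
    · exact Or.inr h
  · intro x k hk hx
    rcases hor x with h | ⟨l, hl⟩
    · rw [hin x h]
      exact f.isTripleMap.mapsInto_fst.1 _ ⟨k, Or.inl (Fin.ext hx)⟩
    · rw [hlast x l hl.le]; exact hmem k
  · intro x y i k hk hx hik hxy hs
    rcases hcross x y i hxy hs with ⟨hx', hy'⟩ | h
    · rw [hin x hx', hin y hy']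
      exact f.isTripleMap.mapsInto_fst.2 _ _
        ⟨k, i, fun l hl => Fin.ext (hxy l hl), Or.inr ⟨hik, Or.inl (Fin.ext hx), hs⟩⟩
    · exact Or.inr h
  · intro x k hk hx
    rcases hor x with h | ⟨l, hl⟩
    · rw [hin x h]
      exact f.eq_base _ k (Or.inl ⟨hk, Fin.ext hx⟩)
    · exact hlast x l hl.le

/-- The transition map of the directed system: for `M ≤ S`, extend `f` from `J_M^{□n}` to
`J_S^{□n}` by the value `f(M₁, …, Mₙ)` outside of `J_M^{□n}`. -/
def TripleGridMap.extend {M S : Fin n → ℕ} (f : TripleGridMap A x₀ M) (hMS : M ≤ S) :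
    TripleGridMap A x₀ S where
  toFun x := f.pad fun k => x k
  isTripleMap :=
    have h := f.pad_isPadded
    IsPadded.isTripleMap ⟨h.base_mem, h.step, h.face, h.face_step, h.base_zero,
      fun x k hk => h.base_last x k ((hMS k).trans hk)⟩

/-! ### Concatenation -/

/-- The least even number that is at least `m`. -/
def evenCeil (m : ℕ) : ℕ := if Even m then m else m + 1

/-- The size of the grid on which a concatenation along coordinate `j` is defined. -/
def concatSize (M L : Fin n → ℕ) (j : Fin n) (k : Fin n) : ℕ :=
  if k = j then M j + L j + 1 else max (M k) (L k)

/-- The formula for the concatenation along coordinate `j`.  Both maps are extended by `x₀` in the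
other coordinates.  For even `M j`, it is `f` where the coordinate `x j` is at most `M j`, and `g`
shifted by `M j` elsewhere.  For odd `M j`, where a shift by `M j` would reverse the arrows, `f` is
first prolonged by one constant layer, so that the shift is `M j + 1`. -/
def concatFun {M L : Fin n → ℕ} (j : Fin n) (f : TripleGridMap A x₀ M) (g : TripleGridMap A x₀ L)
    (x : Fin n → ℕ) : V :=
  if x j ≤ M j then f.pad x else g.pad (Function.update x j (x j - evenCeil (M j)))

theorem concatFun_isPadded {M L : Fin n → ℕ} (j : Fin n) (hj : (j : ℕ) ≠ 0)
    (f : TripleGridMap A x₀ M) (g : TripleGridMap A x₀ L) :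
    IsPadded A x₀ (concatSize M L j) (concatFun j f g) := by
  have hf := f.pad_isPadded
  have hg := g.pad_isPadded
  obtain ⟨he, hMe, heM⟩ :
      Even (evenCeil (M j)) ∧ M j ≤ evenCeil (M j) ∧ evenCeil (M j) ≤ M j + 1 := by
    unfold evenCeil
    split_ifs with h
    · exact ⟨h, by omega, by omega⟩
    · exact ⟨(Nat.not_even_iff_odd.1 h).add_one, by omega, by omega⟩
  set e := evenCeil (M j) with hedef
  have hle : ∀ x : Fin n → ℕ, x j ≤ e → concatFun j f g x = f.pad x := by
    intro x hx
    unfold concatFun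
    split_ifs with h
    · rfl
    · rw [hf.base_last x j (by omega), hg.base_zero _ j hj (by simp [← hedef]; omega)]
  have hge : ∀ x : Fin n → ℕ, e ≤ x j →
      concatFun j f g x = g.pad (Function.update x j (x j - e)) := by
    intro x hx
    unfold concatFun
    split_ifs with h
    · rw [hf.base_last x j (by omega), hg.base_zero _ j hj (by simp; omega)]
    · rfl
  have hside : ∀ (x y : Fin n → ℕ) i, (∀ l, l ≠ i → x l = y l) → StdStep (x i) (y i) →
      (x j ≤ e ∧ y j ≤ e) ∨ (e ≤ x j ∧ e ≤ y j) := by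
    intro x y i hxy hs
    by_cases hij : j = i
    · subst hij
      rcases hs with hs | hs <;> omega
    · have := hxy j hij
      omega
  have hup : ∀ (x y : Fin n → ℕ) i, e ≤ x j → e ≤ y j → (∀ l, l ≠ i → x l = y l) →
      StdStep (x i) (y i) →
      (∀ l, l ≠ i → Function.update x j (x j - e) l = Function.update y j (y j - e) l) ∧
      StdStep (Function.update x j (x j - e) i) (Function.update y j (y j - e) i) := by
    intro x y i hx hy hxy hs
    constructor
    · intro l hl
      by_cases hlj : l = j
      · subst hlj
        simp [hxy l hl]
      · simp [hlj, hxy l hl]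
    · by_cases hij : i = j
      · subst hij
        simp only [Function.update_self]
        rcases hs with ⟨h1, h2⟩ | ⟨h1, h2⟩
        · exact Or.inl ⟨(Nat.even_sub hx).2 (by simp [h1, he]), by omega⟩
        · refine Or.inr ⟨?_, by omega⟩
          rw [Nat.odd_sub hy]
          simp [h1, he]
      · simpa [hij] using hs
  have hbase : ∀ (x : Fin n → ℕ) k, k ≠ j →
      (f.pad x = x₀ ∧ g.pad (Function.update x j (x j - e)) = x₀) → concatFun j f g x = x₀ := by
    intro x k _ h
    rcases le_total (x j) e with hx | hx
    · rw [hle x hx, h.1]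
    · rw [hge x hx, h.2]
  refine ⟨hf.base_mem, ?_, ?_, ?_, ?_, ?_⟩
  · intro x y i hxy hs
    rcases hside x y i hxy hs with ⟨hx, hy⟩ | ⟨hx, hy⟩
    · rw [hle x hx, hle y hy]; exact hf.step x y i hxy hs
    · rw [hge x hx, hge y hy]
      exact hg.step _ _ i (hup x y i hx hy hxy hs).1 (hup x y i hx hy hxy hs).2
  · intro x k hk hx
    have hkj : k ≠ j := fun h => hj (h ▸ hk)
    rcases le_total (x j) e with hxe | hxe
    · rw [hle x hxe]; exact hf.face x k hk hx
    · rw [hge x hxe]; exact hg.face _ k hk (by simp [hkj, hx])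
  · intro x y i k hk hx hik hxy hs
    have hkj : k ≠ j := fun h => hj (h ▸ hk)
    rcases hside x y i hxy hs with ⟨hx', hy'⟩ | ⟨hx', hy'⟩
    · rw [hle x hx', hle y hy']; exact hf.face_step x y i k hk hx hik hxy hs
    · rw [hge x hx', hge y hy']
      exact hg.face_step _ _ i k hk (by simp [hkj, hx]) hik (hup x y i hx' hy' hxy hs).1
        (hup x y i hx' hy' hxy hs).2
  · intro x k hk hx
    by_cases hkj : k = j
    · subst hkj
      rw [hle x (by omega)]; exact hf.base_zero x k hk hx
    · exact hbase x k hkj ⟨hf.base_zero x k hk hx, hg.base_zero _ k hk (by simp [hkj, hx])⟩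
  · intro x k hx
    by_cases hkj : k = j
    · subst hkj
      simp only [concatSize, if_true] at hx
      rw [hge x (by omega)]
      exact hg.base_last _ k (by simp; omega)
    · simp only [concatSize, if_neg hkj, max_le_iff] at hx
      exact hbase x k hkj ⟨hf.base_last x k hx.1, hg.base_last _ k (by simp [hkj, hx.2])⟩

/-- The concatenation `μʲ(f, g)` of triple grid maps along a coordinate `j` other than the first
one (which has index `0`). -/
def concat {M L : Fin n → ℕ} (j : Fin n) (hj : (j : ℕ) ≠ 0) (f : TripleGridMap A x₀ M)
    (g : TripleGridMap A x₀ L) : TripleGridMap A x₀ (concatSize M L j) where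
  toFun x := concatFun j f g fun k => x k
  isTripleMap := (concatFun_isPadded j hj f g).isTripleMap

end Maps

/-! ### The relative homotopy set -/

section HomotopySet

variable {V : Type u} {G : Digraph V} (A : Subdigraph G) (x₀ : V) (n : ℕ)

/-- Two triple grid maps are identified in the direct limit if they agree after extension to a
common larger grid. -/
def LimitRel (p q : Σ M : Fin n → ℕ, TripleGridMap A x₀ M) : Prop :=
  ∃ (S : Fin n → ℕ) (hp : p.1 ≤ S) (hq : q.1 ≤ S), p.2.extend hp = q.2.extend hq

/-- The direct limit `Hom((J, ∂J, J̄)^{□n}; (G, A, x₀))`. -/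
def LimitHom : Type u := Quot (LimitRel A x₀ n)

variable {A x₀ n} in
/-- The class `{f}` of a triple grid map in the direct limit. -/
def LimitHom.mk {M : Fin n → ℕ} (f : TripleGridMap A x₀ M) : LimitHom A x₀ n :=
  Quot.mk _ ⟨M, f⟩

/-- One-step `F`-homotopy on the direct limit. -/
def LimitOneStep (p q : LimitHom A x₀ n) : Prop :=
  ∃ (M L : Fin n → ℕ) (f : TripleGridMap A x₀ M) (g : TripleGridMap A x₀ L),
    LimitHom.mk f = p ∧ LimitHom.mk g = q ∧ OneStep f g

/-- The set `π̄ₙ(G, A) = [(J, ∂J, J̄)^{□n}; (G, A, x₀)]` of `F`-homotopy classes.  `Quot` divides by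
the generated equivalence relation: a finite chain of one-step `F`-homotopies and inverse one-step
`F`-homotopies. -/
def RelHomotopy : Type u := Quot (LimitOneStep A x₀ n)

variable {A x₀ n} in
/-- The `F`-homotopy class `[f]` of a triple grid map. -/
def RelHomotopy.mk {M : Fin n → ℕ} (f : TripleGridMap A x₀ M) : RelHomotopy A x₀ n :=
  Quot.mk _ (LimitHom.mk f)

end HomotopySet

end DigraphHomotopy

namespace DigraphHomotopy

universe w

/-! A triple grid map, extended by `x₀`, is a function on `ℕⁿ`, and the direct limit merely
identifies maps with the same extension. The core of the argument is that subdivision is also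
redundant: `relHomotopyEquiv` identifies `F`-homotopy classes with classes of extended maps under
the equivalence relation generated by direct homotopy alone.

The reason is that a monotone line map onto the relevant range is built from pauses that hold one
value for two extra steps; two is forced because arrows alternate. Moving a pause by one position is
a direct homotopy, and a pause moved beyond the support of a map has no effect. Hence
`PadClass.mk_reparam_pause` and, by removing pauses one at a time,
`PadClass.mk_reparam_of_monotone`.

On extended maps, concatenation is gluing at an even cut-off `e` past the end of the first map.
Increasing `e` by two inserts a pause, so the class does not depend on `e`
(`PadClass.mk_glue_congr`). With suitable cut-offs, associativity, the unit laws and the interchange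
law are equalities of functions. For inverses, a map followed by its reverse is the map composed
with a walk out and back, and lowering the height of that walk step by step ends in the constant map
(`PadClass.exists_mul_eq_one`). Interchange and Eckmann–Hilton give both the independence of the
coordinate and commutativity as soon as two coordinates besides the first exist. -/

section Padded

variable {V : Type w} {G : Digraph V} {A : Subdigraph G} {x₀ : V} {n : ℕ}

/-! ### Extended maps and their direct homotopy classes -/

/-- The direct homotopy relation for functions on `ℕⁿ`. -/
def PadHomotopic (A : Subdigraph G) (φ ψ : (Fin n → ℕ) → V) : Prop :=
  (∀ x, G.Adj (φ x) (ψ x) ∨ φ x = ψ x) ∧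
    ∀ (x : Fin n → ℕ) (k : Fin n), (k : ℕ) = 0 → x k = 0 → A.Adj (φ x) (ψ x) ∨ φ x = ψ x

variable (A x₀ n) in
/-- Triple grid maps extended to `ℕⁿ`. -/
def PaddedMap : Type w := {φ : (Fin n → ℕ) → V // ∃ N, IsPadded A x₀ N φ}

variable (A x₀ n) in
/-- Classes of extended triple grid maps under direct homotopy. -/
def PadClass : Type w := Quot fun φ ψ : PaddedMap A x₀ n => PadHomotopic A φ.1 ψ.1

/-- The class of an extended triple grid map. -/
def PadClass.mk (φ : (Fin n → ℕ) → V) (h : ∃ N, IsPadded A x₀ N φ) : PadClass A x₀ n :=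
  Quot.mk _ ⟨φ, h⟩

theorem PadClass.sound {φ ψ : (Fin n → ℕ) → V} (hφ : ∃ N, IsPadded A x₀ N φ)
    (hψ : ∃ N, IsPadded A x₀ N ψ) (h : PadHomotopic A φ ψ) :
    PadClass.mk φ hφ = PadClass.mk ψ hψ :=
  Quot.sound h

theorem PadClass.mk_congr {φ ψ : (Fin n → ℕ) → V} (hφ : ∃ N, IsPadded A x₀ N φ)
    (hψ : ∃ N, IsPadded A x₀ N ψ) (h : φ = ψ) : PadClass.mk φ hφ = PadClass.mk ψ hψ := by
  subst h; rfl

theorem PadClass.ind {p : PadClass A x₀ n → Prop}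
    (h : ∀ φ (hφ : ∃ N, IsPadded A x₀ N φ), p (PadClass.mk φ hφ)) (a : PadClass A x₀ n) : p a :=
  Quot.ind (fun φ => h φ.1 φ.2) a

/-- The bound enters `IsPadded` only through its last clause, so it may be replaced freely, even by
a smaller one. -/
theorem IsPadded.of_base_last {N K : Fin n → ℕ} {φ : (Fin n → ℕ) → V} (h : IsPadded A x₀ N φ)
    (hK : ∀ (x : Fin n → ℕ) (k : Fin n), K k ≤ x k → φ x = x₀) : IsPadded A x₀ K φ :=
  ⟨h.base_mem, h.step, h.face, h.face_step, h.base_zero, hK⟩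

theorem IsPadded.mono {N K : Fin n → ℕ} {φ : (Fin n → ℕ) → V} (h : IsPadded A x₀ N φ)
    (hNK : N ≤ K) : IsPadded A x₀ K φ :=
  h.of_base_last fun x k hk => h.base_last x k ((hNK k).trans hk)

/-! ### Reparametrizing one coordinate -/

/-- Digraph maps of the infinite standard line. -/
def IsLineMap (h : ℕ → ℕ) : Prop :=
  ∀ a b, StdStep a b → StdStep (h a) (h b) ∨ h a = h b

/-- Arrows leave even vertices and enter odd ones, so a unit move is compatible with them exactly
when its starting point and its image have the same parity. Where `h` stands still, parity is
irrelevant. -/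
theorem IsLineMap.of_succ {h : ℕ → ℕ}
    (hs : ∀ a, h (a + 1) = h a ∨ (h (a + 1) = h a + 1 ∨ h a = h (a + 1) + 1) ∧
      (Even a ↔ Even (h a))) : IsLineMap h := by
  rintro a b (⟨ha, rfl⟩ | ⟨hb, rfl⟩)
  · rcases hs a with h1 | ⟨h1 | h1, h2⟩
    · exact Or.inr h1.symm
    · exact Or.inl (Or.inl ⟨h2.1 ha, h1.symm⟩)
    · refine Or.inl (Or.inr ⟨?_, h1.symm⟩)
      have := h2.1 ha
      rw [h1] at this
      by_contra hc
      rw [Nat.not_odd_iff_even] at hc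
      exact (Nat.even_add_one.1 this) hc
  · have hb' := Nat.not_even_iff_odd.2 hb
    rcases hs b with h1 | ⟨h1 | h1, h2⟩
    · exact Or.inr h1
    · exact Or.inl (Or.inr ⟨Nat.not_even_iff_odd.1 fun h => hb' (h2.2 h), h1.symm⟩)
    · refine Or.inl (Or.inl ⟨?_, h1.symm⟩)
      by_contra hc
      exact hb' (h2.2 (by rw [h1]; exact Nat.even_add_one.2 hc))

/-- Precomposition with a map of the `i`-th coordinate. -/
def reparam (i : Fin n) (h : ℕ → ℕ) (φ : (Fin n → ℕ) → V) (x : Fin n → ℕ) : V :=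
  φ (Function.update x i (h (x i)))

theorem reparam_step {x y : Fin n → ℕ} {i l : Fin n} {h : ℕ → ℕ} (hh : IsLineMap h)
    (hxy : ∀ k, k ≠ l → x k = y k) (hs : StdStep (x l) (y l)) :
    ((∀ k, k ≠ l → Function.update x i (h (x i)) k = Function.update y i (h (y i)) k) ∧
      StdStep (Function.update x i (h (x i)) l) (Function.update y i (h (y i)) l)) ∨
    Function.update x i (h (x i)) = Function.update y i (h (y i)) := by
  by_cases hil : l = i
  · subst hil
    have hne : ∀ k, k ≠ l → Function.update x l (h (x l)) k = Function.update y l (h (y l)) k :=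
      fun k hk => by simp [hk, hxy k hk]
    rcases hh _ _ hs with h1 | h1
    · exact Or.inl ⟨hne, by simpa using h1⟩
    · refine Or.inr (funext fun k => ?_)
      by_cases hk : k = l
      · subst hk; simpa using h1
      · exact hne k hk
  · refine Or.inl ⟨fun k hk => ?_, by simpa [hil] using hs⟩
    by_cases hki : k = i
    · subst hki; simp [hxy k hk]
    · simp [hki, hxy k hk]

theorem IsPadded.reparam {N : Fin n → ℕ} {φ : (Fin n → ℕ) → V} (hφ : IsPadded A x₀ N φ)
    (i : Fin n) {h : ℕ → ℕ} (hh : IsLineMap h) (h0 : h 0 = 0 ∨ ((i : ℕ) ≠ 0 ∧ N i ≤ h 0))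
    (K : ℕ) (hK : ∀ a, K ≤ a → N i ≤ h a ∨ ((i : ℕ) ≠ 0 ∧ h a = 0)) :
    IsPadded A x₀ (Function.update N i K) (reparam i h φ) := by
  have hz : ∀ (x : Fin n → ℕ) (k : Fin n), (k : ℕ) = 0 → x k = 0 →
      Function.update x i (h (x i)) k = 0 := by
    intro x k hk0 hx
    by_cases hk : k = i
    · subst hk; simpa [hx] using h0.resolve_right fun h => h.1 hk0
    · simp [hk, hx]
  refine ⟨hφ.base_mem, ?_, ?_, ?_, ?_, ?_⟩
  · intro x y l hxy hs
    rcases reparam_step (i := i) hh hxy hs with h1 | h1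
    · exact hφ.step _ _ l h1.1 h1.2
    · exact Or.inr (congrArg φ h1)
  · intro x k hk hx
    exact hφ.face _ k hk (hz x k hk hx)
  · intro x y l k hk hx hlk hxy hs
    rcases reparam_step (i := i) hh hxy hs with h1 | h1
    · exact hφ.face_step _ _ l k hk (hz x k hk hx) hlk h1.1 h1.2
    · exact Or.inr (congrArg φ h1)
  · intro x k hk hx
    by_cases hki : k = i
    · subst hki
      rcases h0 with h0 | h0
      · exact hφ.base_zero _ k hk (by simp [hx, h0])
      · exact hφ.base_last _ k (by simpa [hx] using h0.2)
    · exact hφ.base_zero _ k hk (by simp [hki, hx])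
  · intro x k hx
    by_cases hk : k = i
    · subst hk
      rcases hK (x k) (by simpa using hx) with h1 | h1
      · exact hφ.base_last _ k (by simpa using h1)
      · exact hφ.base_zero _ k h1.1 (by simpa using h1.2)
    · exact hφ.base_last _ k (by simpa [hk] using hx)

/-- Each point moves along an arrow in direction `i`. If `i` is the first coordinate, such an arrow
need not lie in the face mapped to `A`; the condition `h0` keeps that face fixed. -/
theorem IsPadded.reparam_homotopic {N : Fin n → ℕ} {φ : (Fin n → ℕ) → V}
    (hφ : IsPadded A x₀ N φ) (i : Fin n) {h h' : ℕ → ℕ} (h0 : h 0 = h' 0)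
    (hs : ∀ a, StdStep (h a) (h' a) ∨ h a = h' a) :
    PadHomotopic A (DigraphHomotopy.reparam i h φ) (DigraphHomotopy.reparam i h' φ) := by
  have hne : ∀ (x : Fin n → ℕ) (l : Fin n), l ≠ i →
      Function.update x i (h (x i)) l = Function.update x i (h' (x i)) l :=
    fun x l hl => by simp [hl]
  refine ⟨fun x => ?_, fun x k hk hx => ?_⟩
  · rcases hs (x i) with h1 | h1
    · exact hφ.step _ _ i (hne x) (by simpa using h1)
    · exact Or.inr (by simp only [DigraphHomotopy.reparam, h1])
  · rcases hs (x i) with h1 | h1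
    · by_cases hki : i = k
      · subst hki
        exact Or.inr (by simp only [DigraphHomotopy.reparam, hx, h0])
      · exact hφ.face_step _ _ i k hk (by simp [Ne.symm hki, hx]) hki (hne x) (by simpa using h1)
    · exact Or.inr (by simp only [DigraphHomotopy.reparam, h1])

/-! ### Pauses -/

/-- The map of the line that stays at `i` for two extra steps. -/
def pause (i a : ℕ) : ℕ := max (min a i) (a - 2)

theorem isLineMap_pause (i : ℕ) : IsLineMap (pause i) := by
  refine IsLineMap.of_succ fun a => ?_
  unfold pause
  rw [Nat.even_iff, Nat.even_iff]
  omega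

/-- The two maps differ only at `i + 1` and `i + 2`, with values `i` and `i + 1`, so the parity of
`i` alone decides the direction of the homotopy. -/
theorem stdStep_pause (i : ℕ) :
    (∀ a, StdStep (pause i a) (pause (i + 1) a) ∨ pause i a = pause (i + 1) a) ∨
    ∀ a, StdStep (pause (i + 1) a) (pause i a) ∨ pause (i + 1) a = pause i a := by
  simp only [StdStep, Nat.even_iff, Nat.odd_iff]
  rcases Nat.mod_two_eq_zero_or_one i with h | h
  · left; intro a; unfold pause; omega
  · right; intro a; unfold pause; omega

theorem IsPadded.exists_reparam_pause {φ : (Fin n → ℕ) → V} (hφ : ∃ N, IsPadded A x₀ N φ)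
    (i : Fin n) (t : ℕ) : ∃ N, IsPadded A x₀ N (DigraphHomotopy.reparam i (pause t) φ) := by
  obtain ⟨N, hφ⟩ := hφ
  exact ⟨_, hφ.reparam i (isLineMap_pause t) (Or.inl (by simp [pause])) (N i + 2)
    fun a ha => Or.inl (by unfold pause; omega)⟩

theorem PadClass.mk_reparam_pause {φ : (Fin n → ℕ) → V} (hφ : ∃ N, IsPadded A x₀ N φ)
    (i : Fin n) (t : ℕ) :
    PadClass.mk (reparam i (pause t) φ) (IsPadded.exists_reparam_pause hφ i t) =
      PadClass.mk φ hφ := by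
  have hsucc : ∀ t, PadClass.mk (reparam i (pause t) φ) (IsPadded.exists_reparam_pause hφ i t) =
      PadClass.mk (reparam i (pause (t + 1)) φ) (IsPadded.exists_reparam_pause hφ i (t + 1)) := by
    intro t
    have h0 : pause t 0 = pause (t + 1) 0 := by simp [pause]
    obtain ⟨N, hN⟩ := id hφ
    rcases stdStep_pause t with h | h
    · exact PadClass.sound _ _ (hN.reparam_homotopic i h0 h)
    · exact (PadClass.sound _ _ (hN.reparam_homotopic i h0.symm h)).symm
  have hadd : ∀ d, PadClass.mk (reparam i (pause t) φ) (IsPadded.exists_reparam_pause hφ i t) =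
      PadClass.mk (reparam i (pause (t + d)) φ) (IsPadded.exists_reparam_pause hφ i (t + d)) := by
    intro d
    induction d with
    | zero => rfl
    | succ d ih => exact ih.trans (hsucc _)
  obtain ⟨N, hN⟩ := id hφ
  -- At position `t + N i` the pause only affects points where the map is already constantly `x₀`.
  refine (hadd (N i)).trans (PadClass.mk_congr _ _ (funext fun x => ?_))
  by_cases hx : x i ≤ t + N i
  · have : pause (t + N i) (x i) = x i := by unfold pause; omega
    simp [reparam, this]
  · rw [hN.base_last x i (by omega), reparam]
    exact hN.base_last _ i (by simp [pause]; omega)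

/-- Monotone reparametrizations do not change the class. -/
theorem PadClass.mk_reparam_of_monotone {φ : (Fin n → ℕ) → V} {N : Fin n → ℕ}
    (hN : IsPadded A x₀ N φ) (i : Fin n) (K : ℕ) : ∀ {h : ℕ → ℕ}, IsLineMap h → h 0 = 0 →
    Monotone h → N i ≤ h K → ∀ hφ', PadClass.mk (reparam i h φ) hφ' = PadClass.mk φ ⟨N, hN⟩ := by
  induction K using Nat.strong_induction_on with
  | _ K ih =>
  intro h hh h0 hm hK hφ'
  by_cases hid : ∀ a, a ≤ N i → h a = a
  · refine PadClass.mk_congr _ _ (funext fun x => ?_)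
    rcases le_total (x i) (N i) with hx | hx
    · simp [reparam, hid _ hx]
    · rw [hN.base_last x i hx, reparam]
      refine hN.base_last _ i ?_
      simpa [hid _ le_rfl] using hm hx
  · push Not at hid
    classical
    -- The first failure of `h a = a` is at `b + 1`, where `h` stays at `b`. Parity forces it to
    -- stay for `b + 2` as well, so `h` factors through `pause b`.
    obtain ⟨b, hb⟩ : ∃ b, Nat.find hid = b + 1 := by
      refine Nat.exists_eq_succ_of_ne_zero fun hz => (Nat.find_spec hid).2 ?_
      rw [hz, h0]
    obtain ⟨hbN, hbne⟩ := Nat.find_spec hid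
    rw [hb] at hbN hbne
    have hlt : ∀ a, a ≤ b → h a = a := by
      intro a ha
      by_contra hc
      exact Nat.find_min hid (m := a) (by omega) ⟨by omega, hc⟩
    have hstep : ∀ a, h (a + 1) = h a ∨ (h (a + 1) = h a + 1 ∧ (Even a ↔ Even (h a))) := by
      intro a
      have hma : h a ≤ h (a + 1) := hm (Nat.le_succ a)
      rcases Nat.even_or_odd a with ha | ha
      · rcases hh a (a + 1) (Or.inl ⟨ha, rfl⟩) with (h1 | h1) | h1
        · exact Or.inr ⟨h1.2.symm, by simp [ha, h1.1]⟩
        · omega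
        · exact Or.inl h1.symm
      · rcases hh (a + 1) a (Or.inr ⟨ha, rfl⟩) with (h1 | h1) | h1
        · omega
        · refine Or.inr ⟨h1.2.symm, ?_⟩
          simp [Nat.not_even_iff_odd.2 ha, Nat.not_even_iff_odd.2 h1.1]
        · exact Or.inl h1
    have hb0 := hlt b le_rfl
    have hb1 : h (b + 1) = b := by
      rcases hstep b with h1 | h1 <;> omega
    have hb2 : h (b + 2) = b := by
      rcases hstep (b + 1) with h1 | h1
      · exact h1.trans hb1
      · have := h1.2
        rw [hb1, Nat.even_add_one] at this
        tauto
    have hbK : b + 2 < K := by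
      by_contra hc
      have := hm (show K ≤ b + 2 by omega)
      omega
    -- Deleting the two idle steps gives a map that reaches `N i` already at `K - 2`, which drives
    -- the induction.
    set h' : ℕ → ℕ := fun a => if a ≤ b then h a else h (a + 2) with hh'
    have hh'1 : ∀ a, a ≤ b → h' a = h a := fun a ha => if_pos ha
    have hh'2 : ∀ a, b ≤ a → h' a = h (a + 2) := by
      intro a ha
      rcases ha.eq_or_lt with rfl | ha
      · rw [hh'1 _ le_rfl, hb2, hb0]
      · exact if_neg (by omega)
    have hstep' : ∀ a, h' (a + 1) = h' a ∨ (h' (a + 1) = h' a + 1 ∧ (Even a ↔ Even (h' a))) := by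
      intro a
      rcases lt_or_ge a b with ha | ha
      · rw [hh'1 a ha.le, hh'1 (a + 1) ha]; exact hstep a
      · rw [hh'2 a ha, hh'2 (a + 1) (by omega)]
        have := hstep (a + 2)
        rwa [Nat.even_add, iff_true_right even_two] at this
    have hl' : IsLineMap h' := by
      refine IsLineMap.of_succ fun a => ?_
      rcases hstep' a with h1 | h1
      · exact Or.inl h1
      · exact Or.inr ⟨Or.inl h1.1, h1.2⟩
    have h0' : h' 0 = 0 := (hh'1 0 (Nat.zero_le _)).trans h0
    have hm' : Monotone h' := monotone_nat_of_le_succ fun a => by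
      rcases hstep' a with h1 | h1 <;> omega
    have hK' : N i ≤ h' (K - 2) := by
      rw [hh'2 _ (by omega), Nat.sub_add_cancel (by omega)]; exact hK
    have hφ'' : ∃ S, IsPadded A x₀ S (reparam i h' φ) :=
      ⟨_, hN.reparam i hl' (Or.inl h0') (K - 2) fun a ha => Or.inl (hK'.trans (hm' ha))⟩
    have key : reparam i h φ = reparam i (pause b) (reparam i h' φ) := by
      funext x
      simp only [reparam, Function.update_self, Function.update_idem]
      congr 2
      rcases le_total (x i) b with hx | hx
      · have hp : pause b (x i) = x i := by unfold pause; omega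
        rw [hp, hh'1 _ hx]
      · rcases le_total (x i) (b + 2) with hx2 | hx2
        · have hp : pause b (x i) = b := by unfold pause; omega
          rw [hp, hh'1 _ le_rfl, hb0]
          have h1 := hm hx
          have h2 := hm hx2
          omega
        · have hp : pause b (x i) = x i - 2 := by unfold pause; omega
          rw [hp, hh'2 _ (by omega), Nat.sub_add_cancel (by omega)]
    calc PadClass.mk (reparam i h φ) hφ'
        = PadClass.mk (reparam i (pause b) (reparam i h' φ))
          (IsPadded.exists_reparam_pause hφ'' i b) := PadClass.mk_congr _ _ key
      _ = PadClass.mk (reparam i h' φ) hφ'' := PadClass.mk_reparam_pause hφ'' i b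
      _ = PadClass.mk φ ⟨N, hN⟩ := ih (K - 2) (by omega) hl' h0' hm' hK' hφ''

/-- Monotone reparametrizations of several coordinates do not change the class. -/
theorem PadClass.mk_comp_of_monotone {φ : (Fin n → ℕ) → V} {N : Fin n → ℕ}
    (hN : IsPadded A x₀ N φ) (K : Fin n → ℕ) (h : Fin n → ℕ → ℕ) (hh : ∀ i, IsLineMap (h i))
    (h0 : ∀ i, h i 0 = 0) (hm : ∀ i, Monotone (h i)) (hK : ∀ i, N i ≤ h i (K i))
    (hφ' : ∃ S, IsPadded A x₀ S fun x => φ fun i => h i (x i)) :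
    PadClass.mk _ hφ' = PadClass.mk φ ⟨N, hN⟩ := by
  classical
  have key : ∀ s : Finset (Fin n), ∃ hs : ∃ S, IsPadded A x₀ S
      fun x => φ fun i => if i ∈ s then h i (x i) else x i,
      PadClass.mk _ hs = PadClass.mk φ ⟨N, hN⟩ := by
    intro s
    induction s using Finset.induction_on with
    | empty =>
      refine ⟨⟨N, by simpa using hN⟩, PadClass.mk_congr _ _ (by simp)⟩
    | insert i s his ih =>
      obtain ⟨⟨S, hS⟩, ih⟩ := ih
      have e : (fun x : Fin n → ℕ => φ fun l => if l ∈ insert i s then h l (x l) else x l) =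
          reparam i (h i) (fun x => φ fun l => if l ∈ s then h l (x l) else x l) := by
        funext x
        unfold reparam
        congr 1
        funext l
        by_cases hl : l = i
        · subst hl; simp [his]
        · simp [hl]
      -- The bound `S` from the induction is unknown in direction `i`, but that coordinate has not
      -- been altered yet, so the original bound `N i` is still valid there.
      have hSN : IsPadded A x₀ (Function.update S i (N i))
          (fun x => φ fun l => if l ∈ s then h l (x l) else x l) := by
        refine hS.of_base_last fun x k hk => ?_
        by_cases hki : k = i
        · subst hki
          exact hN.base_last _ k (by simpa [his] using hk)
        · exact hS.base_last x k (by simpa [hki] using hk)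
      have hp : ∃ S', IsPadded A x₀ S' (reparam i (h i)
          (fun x => φ fun l => if l ∈ s then h l (x l) else x l)) :=
        ⟨_, hSN.reparam i (hh i) (Or.inl (h0 i)) (K i) fun a ha => Or.inl (by
          simpa using (hK i).trans (hm i ha))⟩
      refine ⟨e ▸ hp, (PadClass.mk_congr _ hp e).trans ?_⟩
      refine (PadClass.mk_reparam_of_monotone hSN i (K i) (hh i) (h0 i) (hm i) ?_ hp).trans ih
      simpa using hK i
  obtain ⟨hs, h1⟩ := key Finset.univ
  exact (PadClass.mk_congr _ _ (by simp)).trans h1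

/-! ### Comparison with triple grid maps -/

/-- The restriction to a grid of an extended triple grid map. -/
def IsPadded.restrict {N : Fin n → ℕ} {φ : (Fin n → ℕ) → V} (h : IsPadded A x₀ N φ) :
    TripleGridMap A x₀ N :=
  ⟨fun x => φ fun k => x k, h.isTripleMap⟩

theorem TripleGridMap.pad_of_le {M : Fin n → ℕ} (f : TripleGridMap A x₀ M) {x : Fin n → ℕ}
    (h : ∀ k, x k ≤ M k) : f.pad x = f.toFun fun k => ⟨x k, Nat.lt_succ_of_le (h k)⟩ :=
  dif_pos h

theorem TripleGridMap.pad_coe {M : Fin n → ℕ} (f : TripleGridMap A x₀ M) (x : GridVertex M) :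
    (f.pad fun k => (x k : ℕ)) = f.toFun x :=
  f.pad_of_le fun k => Nat.le_of_lt_succ (x k).2

theorem TripleGridMap.ext_pad {M : Fin n → ℕ} {f g : TripleGridMap A x₀ M} (h : f.pad = g.pad) :
    f = g := by
  have : f.toFun = g.toFun := funext fun x => by rw [← f.pad_coe, ← g.pad_coe, h]
  cases f; cases g; cases this; rfl

theorem IsPadded.pad_restrict {N : Fin n → ℕ} {φ : (Fin n → ℕ) → V} (h : IsPadded A x₀ N φ) :
    h.restrict.pad = φ := by
  funext x
  by_cases hx : ∀ k, x k ≤ N k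
  · rw [TripleGridMap.pad_of_le _ hx]; rfl
  · push Not at hx
    obtain ⟨k, hk⟩ := hx
    rw [h.restrict.pad_isPadded.base_last x k hk.le, h.base_last x k hk.le]

theorem TripleGridMap.pad_extend {M S : Fin n → ℕ} (f : TripleGridMap A x₀ M) (h : M ≤ S) :
    (f.extend h).pad = f.pad :=
  (f.pad_isPadded.mono h).pad_restrict

theorem LimitHom.mk_eq_of_pad_eq {M L : Fin n → ℕ} {f : TripleGridMap A x₀ M}
    {g : TripleGridMap A x₀ L} (h : f.pad = g.pad) : LimitHom.mk f = LimitHom.mk g :=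
  Quot.sound ⟨M ⊔ L, le_sup_left, le_sup_right,
    TripleGridMap.ext_pad (by rw [f.pad_extend, g.pad_extend, h])⟩

/-- `PadHomotopic` constrains only the open face; on the rest of the boundary both maps are `x₀`,
and the homotopy is stationary. -/
theorem directHomotopic_of_padHomotopic {M : Fin n → ℕ} {f g : TripleGridMap A x₀ M}
    (h : PadHomotopic A f.pad g.pad) : DirectHomotopic f g := by
  have hG : ∀ x, G.Adj (f.toFun x) (g.toFun x) ∨ f.toFun x = g.toFun x := fun x => by
    simpa only [TripleGridMap.pad_coe] using h.1 fun k => x k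
  have hbase : ∀ x ∈ (gridCap M).verts, f.toFun x = x₀ ∧ g.toFun x = x₀ := fun x hx =>
    ⟨f.isTripleMap.mapsInto_snd.1 x hx, g.isTripleMap.mapsInto_snd.1 x hx⟩
  have hA : ∀ x ∈ (gridBoundary M).verts,
      A.Adj (f.toFun x) (g.toFun x) ∨ f.toFun x = g.toFun x := by
    rintro x ⟨k, hk⟩
    by_cases hc : (k : ℕ) = 0 ∧ x k = 0
    · simpa only [TripleGridMap.pad_coe] using h.2 (fun k => x k) k hc.1 (by simp [hc.2])
    · have hk' : ((k : ℕ) ≠ 0 ∧ x k = 0) ∨ x k = Fin.last (M k) := by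
        rcases hk with hk | hk
        · exact Or.inl ⟨fun h0 => hc ⟨h0, hk⟩, hk⟩
        · exact Or.inr hk
      exact Or.inr ((f.eq_base x k hk').trans (g.eq_base x k hk').symm)
  have h01 : ∀ {a b : Fin (1 + 1)}, (stdLine 1).Adj a b → a = 0 ∧ b = 1 := by
    intro a b hab
    have ha := a.2
    have hb := b.2
    rcases hab with ⟨h1, h2⟩ | ⟨h1, h2⟩
    · exact ⟨Fin.ext (by simp; omega), Fin.ext (by simp; omega)⟩
    · rw [Nat.odd_iff] at h1; omega
  have hcases : ∀ t : Fin (1 + 1), t = 0 ∨ t = 1 := by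
    intro t
    have := t.2
    rcases (show (t : ℕ) = 0 ∨ (t : ℕ) = 1 by omega) with ht | ht
    · exact Or.inl (Fin.ext ht)
    · exact Or.inr (Fin.ext ht)
  have h10 : (1 : Fin (1 + 1)) ≠ 0 := by decide
  refine ⟨fun p => if p.2 = 0 then f.toFun p.1 else g.toFun p.1, ⟨?_, ⟨?_, ?_⟩, ?_, ?_⟩,
    fun x => if_pos rfl, fun x => if_neg h10⟩
  · rintro ⟨x, s⟩ ⟨y, t⟩ (⟨hxy, hst⟩ | ⟨hxy, hst⟩)
    · obtain ⟨rfl, rfl⟩ := h01 hst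
      obtain rfl : x = y := hxy
      simpa [h10] using hG x
    · obtain rfl : s = t := hst
      rcases hcases s with rfl | rfl
      · simpa using f.isTripleMap.isDigraphMap x y hxy
      · simpa [h10] using g.isTripleMap.isDigraphMap x y hxy
  · rintro ⟨x, s⟩ hx
    rcases hcases s with rfl | rfl
    · simpa using f.isTripleMap.mapsInto_fst.1 x hx
    · simpa [h10] using g.isTripleMap.mapsInto_fst.1 x hx
  · rintro ⟨x, s⟩ ⟨y, t⟩ (⟨hxy, hx, hst⟩ | ⟨hxy, hst⟩)
    · obtain ⟨rfl, rfl⟩ := h01 hst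
      obtain rfl : x = y := hxy
      simpa [h10] using hA x hx
    · obtain rfl : s = t := hst
      rcases hcases s with rfl | rfl
      · simpa using f.isTripleMap.mapsInto_fst.2 x y hxy
      · simpa [h10] using g.isTripleMap.mapsInto_fst.2 x y hxy
  · rintro ⟨x, s⟩ hx
    have := hbase x hx
    change (if s = 0 then f.toFun x else g.toFun x) = x₀
    split_ifs
    exacts [this.1, this.2]
  · rintro ⟨x, s⟩ ⟨y, t⟩ hxy
    have hx := hbase x (((gridCap M).cylinder (stdLine 1)).left_mem hxy)
    have hy := hbase y (((gridCap M).cylinder (stdLine 1)).right_mem hxy)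
    right
    simp only [hx.1, hx.2, hy.1, hy.2, ite_self]

theorem DirectHomotopic.padHomotopic {M : Fin n → ℕ} {f g : TripleGridMap A x₀ M}
    (h : DirectHomotopic f g) : PadHomotopic A f.pad g.pad := by
  obtain ⟨F, hF, hf, hg⟩ := h
  have h01 : (stdLine 1).Adj 0 1 := Or.inl ⟨by simp, rfl⟩
  have hor : ∀ x : Fin n → ℕ, f.pad x = g.pad x ∨ ∃ y : GridVertex M, x = fun k => (y k : ℕ) := by
    intro x
    by_cases hx : ∀ k, x k ≤ M k
    · exact Or.inr ⟨fun k => ⟨x k, Nat.lt_succ_of_le (hx k)⟩, rfl⟩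
    · push Not at hx
      obtain ⟨k, hk⟩ := hx
      exact Or.inl ((f.pad_isPadded.base_last x k hk.le).trans
        (g.pad_isPadded.base_last x k hk.le).symm)
  refine ⟨fun x => ?_, fun x k hk hx => ?_⟩
  · rcases hor x with h | ⟨y, rfl⟩
    · exact Or.inr h
    · rw [f.pad_coe, g.pad_coe, ← hf, ← hg]
      exact hF.isDigraphMap _ _ (Or.inl ⟨rfl, h01⟩)
  · rcases hor x with h | ⟨y, rfl⟩
    · exact Or.inr h
    · rw [f.pad_coe, g.pad_coe, ← hf, ← hg]
      exact hF.mapsInto_fst.2 _ _ (Or.inl ⟨rfl, ⟨k, Or.inl (Fin.ext hx)⟩, h01⟩)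

theorem TripleGridMap.exists_isPadded {M : Fin n → ℕ} (f : TripleGridMap A x₀ M) :
    ∃ N, IsPadded A x₀ N f.pad :=
  ⟨M, f.pad_isPadded⟩

theorem IsSubdivision.padClass_eq {K M : Fin n → ℕ} {f' : TripleGridMap A x₀ K}
    {f : TripleGridMap A x₀ M} (h : IsSubdivision f' f) :
    PadClass.mk f'.pad f'.exists_isPadded = PadClass.mk f.pad f.exists_isPadded := by
  obtain ⟨h, hh, hf⟩ := h
  -- The shrinking maps are continued to the infinite line by their last values `M i`, where `f.pad`
  -- is already `x₀`.
  set h' : Fin n → ℕ → ℕ := fun i a => h i ⟨min a (K i), by omega⟩ with hdef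
  have hle : ∀ i a, K i ≤ a → h' i a = M i := by
    intro i a ha
    have : (⟨min a (K i), by omega⟩ : Fin (K i + 1)) = Fin.last (K i) := Fin.ext (by simp [ha])
    simp only [hdef, this, (hh i).map_last, Fin.val_last]
  have hline : ∀ i, IsLineMap (h' i) := by
    intro i a b hab
    by_cases hc : a ≤ K i ∧ b ≤ K i
    · have hs : (stdLine (K i)).Adj ⟨min a (K i), by omega⟩ ⟨min b (K i), by omega⟩ := by
        simpa [stdLine, hc.1, hc.2] using hab
      rcases (hh i).isDigraphMap _ _ hs with h1 | h1
      · exact Or.inl h1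
      · exact Or.inr (congrArg Fin.val h1)
    · right
      have : K i ≤ a ∧ K i ≤ b := by
        rcases hab with h1 | h1 <;> omega
      rw [hle i a this.1, hle i b this.2]
  have hzero : ∀ i, h' i 0 = 0 := by
    intro i
    have : (⟨min 0 (K i), by omega⟩ : Fin (K i + 1)) = 0 := Fin.ext (by simp)
    simp only [hdef, this, (hh i).map_zero, Fin.val_zero]
  have hmono : ∀ i, Monotone (h' i) := fun i a b hab =>
    (hh i).monotone (Fin.mk_le_mk.2 (min_le_min_right _ hab))
  have e : f'.pad = fun x => f.pad fun i => h' i (x i) := by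
    funext x
    by_cases hx : ∀ k, x k ≤ K k
    · rw [f'.pad_of_le hx, hf, ← f.pad_coe]
      simp only [hdef, min_eq_left (hx _)]
    · push Not at hx
      obtain ⟨k, hk⟩ := hx
      rw [f'.pad_isPadded.base_last x k hk.le,
        f.pad_isPadded.base_last _ k (hle k _ hk.le).ge]
  have hp : ∃ S, IsPadded A x₀ S fun x => f.pad fun i => h' i (x i) := e ▸ f'.exists_isPadded
  exact (PadClass.mk_congr _ hp e).trans (PadClass.mk_comp_of_monotone f.pad_isPadded K h' hline
    hzero hmono (fun i => (hle i _ le_rfl).ge) hp)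

theorem OneStep.padClass_eq {M L : Fin n → ℕ} {f : TripleGridMap A x₀ M}
    {g : TripleGridMap A x₀ L} (h : OneStep f g) :
    PadClass.mk f.pad f.exists_isPadded = PadClass.mk g.pad g.exists_isPadded := by
  obtain ⟨K, f', g', hf, hg, hd⟩ := h
  exact hf.padClass_eq.symm.trans
    ((PadClass.sound _ _ hd.padHomotopic).trans hg.padClass_eq)

theorem IsSubdivision.refl {M : Fin n → ℕ} (f : TripleGridMap A x₀ M) : IsSubdivision f f :=
  ⟨fun _ a => a, fun _ => ⟨fun _ _ h => Or.inl h, rfl, rfl, monotone_id⟩, fun _ => rfl⟩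

theorem RelHomotopy.mk_eq_of_pad_eq {M L : Fin n → ℕ} {f : TripleGridMap A x₀ M}
    {g : TripleGridMap A x₀ L} (h : f.pad = g.pad) : RelHomotopy.mk f = RelHomotopy.mk g :=
  congrArg (Quot.mk _) (LimitHom.mk_eq_of_pad_eq h)

theorem RelHomotopy.mk_eq_of_padHomotopic {M L : Fin n → ℕ} {f : TripleGridMap A x₀ M}
    {g : TripleGridMap A x₀ L} (h : PadHomotopic A f.pad g.pad) :
    RelHomotopy.mk f = RelHomotopy.mk g := by
  have hf := f.pad_extend (le_sup_left : M ≤ M ⊔ L)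
  have hg := g.pad_extend (le_sup_right : L ≤ M ⊔ L)
  rw [RelHomotopy.mk_eq_of_pad_eq hf.symm, RelHomotopy.mk_eq_of_pad_eq hg.symm]
  rw [← hf, ← hg] at h
  exact Quot.sound ⟨_, _, _, _, rfl, rfl, _, _, _, IsSubdivision.refl _, IsSubdivision.refl _,
    directHomotopic_of_padHomotopic h⟩

variable (A x₀ n) in
/-- `F`-homotopy classes are classes of extended triple grid maps under direct homotopy. -/
noncomputable def relHomotopyEquiv : RelHomotopy A x₀ n ≃ PadClass A x₀ n where
  toFun := Quot.lift
    (Quot.lift (fun p : Σ M : Fin n → ℕ, TripleGridMap A x₀ M =>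
        PadClass.mk p.2.pad p.2.exists_isPadded) (by
      rintro ⟨M, f⟩ ⟨L, g⟩ ⟨S, hf, hg, h⟩
      refine PadClass.mk_congr _ _ ?_
      rw [← f.pad_extend hf, ← g.pad_extend hg]
      exact congrArg TripleGridMap.pad h))
    (by
      rintro _ _ ⟨M, L, f, g, rfl, rfl, h⟩
      exact h.padClass_eq)
  invFun := Quot.lift (fun φ => RelHomotopy.mk φ.2.choose_spec.restrict) (by
    rintro φ ψ h
    refine RelHomotopy.mk_eq_of_padHomotopic ?_
    rwa [IsPadded.pad_restrict, IsPadded.pad_restrict])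
  left_inv := by
    rintro ⟨⟨M, f⟩⟩
    exact RelHomotopy.mk_eq_of_pad_eq (IsPadded.pad_restrict _)
  right_inv := by
    rintro ⟨φ, hφ⟩
    exact PadClass.mk_congr (TripleGridMap.exists_isPadded _) hφ
      (IsPadded.pad_restrict hφ.choose_spec)

/-! ### Concatenation of extended maps -/

/-- `φ` followed along coordinate `j` by `ψ`, shifted by `e`. -/
def glue (j : Fin n) (e : ℕ) (φ ψ : (Fin n → ℕ) → V) (x : Fin n → ℕ) : V :=
  if x j ≤ e then φ x else ψ (Function.update x j (x j - e))

/-- `e` is an even number such that `φ` is constant where the coordinate `j` is at least `e`. -/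
def IsEnd (x₀ : V) (j : Fin n) (e : ℕ) (φ : (Fin n → ℕ) → V) : Prop :=
  Even e ∧ ∀ x, e ≤ x j → φ x = x₀

theorem IsEnd.mono {j : Fin n} {e d : ℕ} {φ : (Fin n → ℕ) → V} (h : IsEnd x₀ j e φ)
    (hd : Even d) (hed : e ≤ d) : IsEnd x₀ j d φ :=
  ⟨hd, fun x hx => h.2 x (hed.trans hx)⟩

theorem IsPadded.isEnd {N : Fin n → ℕ} {φ : (Fin n → ℕ) → V} (h : IsPadded A x₀ N φ)
    (j : Fin n) : IsEnd x₀ j (2 * N j) φ :=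
  ⟨even_two_mul _, fun x hx => h.base_last x j (by omega)⟩

theorem exists_common_isEnd {φ ψ : (Fin n → ℕ) → V} (hφ : ∃ N, IsPadded A x₀ N φ)
    (hψ : ∃ N, IsPadded A x₀ N ψ) (j : Fin n) : ∃ e, IsEnd x₀ j e φ ∧ IsEnd x₀ j e ψ := by
  obtain ⟨N, hN⟩ := hφ
  obtain ⟨L, hL⟩ := hψ
  have he : Even (2 * N j + 2 * L j) := (even_two_mul _).add (even_two_mul _)
  exact ⟨_, (hN.isEnd j).mono he (by omega), (hL.isEnd j).mono he (by omega)⟩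

theorem evenCeil_of_even {m : ℕ} (h : Even m) : evenCeil m = m := if_pos h

/-- The two formulas can disagree only on the layer `M j + 1` for odd `M j`; there `f` has ended and
`g` is at its start, so both give `x₀`. -/
theorem glue_eq_concatFun {M L : Fin n → ℕ} (j : Fin n) (hj : (j : ℕ) ≠ 0)
    (f : TripleGridMap A x₀ M) (g : TripleGridMap A x₀ L) :
    glue j (evenCeil (M j)) f.pad g.pad = concatFun j f g := by
  have he : M j ≤ evenCeil (M j) ∧ evenCeil (M j) ≤ M j + 1 := by
    unfold evenCeil; split_ifs <;> omega
  funext x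
  unfold glue concatFun
  split_ifs with h1 h2 h2
  · rfl
  · rw [f.pad_isPadded.base_last x j (by omega), g.pad_isPadded.base_zero _ j hj (by simp; omega)]
  · omega
  · rfl

theorem isEnd_evenCeil {M : Fin n → ℕ} (f : TripleGridMap A x₀ M) (j : Fin n) :
    IsEnd x₀ j (evenCeil (M j)) f.pad := by
  unfold evenCeil
  split_ifs with h
  · exact ⟨h, fun x hx => f.pad_isPadded.base_last x j hx⟩
  · exact ⟨Nat.even_add_one.2 h, fun x hx => f.pad_isPadded.base_last x j (by omega)⟩

theorem glue_isPadded {φ ψ : (Fin n → ℕ) → V} (hφ : ∃ N, IsPadded A x₀ N φ)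
    (hψ : ∃ N, IsPadded A x₀ N ψ) {j : Fin n} (hj : (j : ℕ) ≠ 0) {e : ℕ} (he : IsEnd x₀ j e φ) :
    ∃ N, IsPadded A x₀ N (glue j e φ ψ) := by
  obtain ⟨N, hN⟩ := hφ
  obtain ⟨L, hL⟩ := hψ
  -- With `j`-th bound equal to the even number `e`, the shift used by `concatFun` is `e` itself.
  have hN' : IsPadded A x₀ (Function.update N j e) φ := hN.of_base_last fun x k hk => by
    by_cases hkj : k = j
    · subst hkj; exact he.2 x (by simpa using hk)
    · exact hN.base_last x k (by simpa [hkj] using hk)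
  have h := concatFun_isPadded j hj hN'.restrict hL.restrict
  rw [← glue_eq_concatFun j hj, IsPadded.pad_restrict, IsPadded.pad_restrict,
    Function.update_self, evenCeil_of_even he.1] at h
  exact ⟨_, h⟩

/-- The later gluing is the earlier one composed with `pause e`: the two additional layers wait at
`x₀`. -/
theorem PadClass.mk_glue_add_two {φ ψ : (Fin n → ℕ) → V} (hφ : ∃ N, IsPadded A x₀ N φ)
    (hψ : ∃ N, IsPadded A x₀ N ψ) {j : Fin n} (hj : (j : ℕ) ≠ 0) {e : ℕ} (he : IsEnd x₀ j e φ)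
    (he' : IsEnd x₀ j (e + 2) φ) :
    PadClass.mk (glue j (e + 2) φ ψ) (glue_isPadded hφ hψ hj he') =
      PadClass.mk (glue j e φ ψ) (glue_isPadded hφ hψ hj he) := by
  refine (PadClass.mk_congr _ (IsPadded.exists_reparam_pause (glue_isPadded hφ hψ hj he) j e)
    (funext fun x => ?_)).trans (PadClass.mk_reparam_pause (glue_isPadded hφ hψ hj he) j e)
  simp only [glue, reparam, Function.update_self, Function.update_idem]
  rcases le_or_gt (x j) e with h1 | h1
  · have hp : pause e (x j) = x j := by unfold pause; omega
    rw [hp, if_pos (by omega), if_pos h1, Function.update_eq_self]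
  · rcases le_or_gt (x j) (e + 2) with h2 | h2
    · have hp : pause e (x j) = e := by unfold pause; omega
      rw [hp, if_pos h2, if_pos le_rfl, he.2 x h1.le, he.2 _ (by simp)]
    · have hp : pause e (x j) = x j - 2 := by unfold pause; omega
      rw [hp, if_neg (by omega), if_neg (by omega), Nat.sub_sub, add_comm 2 e]

theorem PadClass.mk_glue_congr {φ ψ : (Fin n → ℕ) → V} (hφ : ∃ N, IsPadded A x₀ N φ)
    (hψ : ∃ N, IsPadded A x₀ N ψ) {j : Fin n} (hj : (j : ℕ) ≠ 0) {e d : ℕ}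
    (he : IsEnd x₀ j e φ) (hd : IsEnd x₀ j d φ) :
    PadClass.mk (glue j e φ ψ) (glue_isPadded hφ hψ hj he) =
      PadClass.mk (glue j d φ ψ) (glue_isPadded hφ hψ hj hd) := by
  wlog hed : e ≤ d generalizing e d
  · exact (this hd he (by omega)).symm
  obtain ⟨a, ha⟩ := he.1
  obtain ⟨b, hb⟩ := hd.1
  obtain ⟨c, rfl⟩ : ∃ c, d = e + 2 * c := ⟨b - a, by omega⟩
  clear hb hed
  induction c with
  | zero => rfl
  | succ c ih =>
    have hc : IsEnd x₀ j (e + 2 * c) φ := he.mono (he.1.add (even_two_mul c)) (by omega)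
    exact (ih hc).trans (PadClass.mk_glue_add_two hφ hψ hj hc hd).symm

theorem PadHomotopic.refl (A : Subdigraph G) (φ : (Fin n → ℕ) → V) : PadHomotopic A φ φ :=
  ⟨fun _ => Or.inr rfl, fun _ _ _ _ => Or.inr rfl⟩

theorem PadHomotopic.glue {φ φ' ψ ψ' : (Fin n → ℕ) → V} (h : PadHomotopic A φ φ')
    (h' : PadHomotopic A ψ ψ') {j : Fin n} (hj : (j : ℕ) ≠ 0) (e : ℕ) :
    PadHomotopic A (glue j e φ ψ) (glue j e φ' ψ') := by
  refine ⟨fun x => ?_, fun x k hk hx => ?_⟩ <;> unfold DigraphHomotopy.glue <;> split_ifs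
  · exact h.1 x
  · exact h'.1 _
  · exact h.2 x k hk hx
  · have hkj : k ≠ j := fun h => hj (h ▸ hk)
    exact h'.2 _ k hk (by simp [hkj, hx])

/-! ### The product on classes: unit and associativity -/

/-- Concatenation of classes along coordinate `j`. -/
noncomputable def PadClass.mul (j : Fin n) (hj : (j : ℕ) ≠ 0) (a b : PadClass A x₀ n) :
    PadClass A x₀ n :=
  Quot.lift₂ (fun φ ψ : PaddedMap A x₀ n =>
      PadClass.mk (glue j _ φ.1 ψ.1) (glue_isPadded φ.2 ψ.2 hj (φ.2.choose_spec.isEnd j)))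
    (fun _ _ _ h => PadClass.sound _ _ ((PadHomotopic.refl A _).glue h hj _))
    (fun φ φ' ψ h => by
      -- Homotopic first factors may come with different chosen cut-offs, so both are moved to a
      -- common one before gluing the homotopy.
      obtain ⟨e, he, he'⟩ := exists_common_isEnd φ.2 φ'.2 j
      exact (PadClass.mk_glue_congr φ.2 ψ.2 hj (φ.2.choose_spec.isEnd j) he).trans
        ((PadClass.sound _ (glue_isPadded φ'.2 ψ.2 hj he')
          (h.glue (PadHomotopic.refl A _) hj e)).trans
        (PadClass.mk_glue_congr φ'.2 ψ.2 hj he' (φ'.2.choose_spec.isEnd j)))) a b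

theorem PadClass.mul_mk {j : Fin n} (hj : (j : ℕ) ≠ 0) {φ ψ : (Fin n → ℕ) → V}
    (hφ : ∃ N, IsPadded A x₀ N φ) (hψ : ∃ N, IsPadded A x₀ N ψ) {e : ℕ}
    (he : IsEnd x₀ j e φ) : PadClass.mul j hj (PadClass.mk φ hφ) (PadClass.mk ψ hψ) =
      PadClass.mk (glue j e φ ψ) (glue_isPadded hφ hψ hj he) :=
  PadClass.mk_glue_congr hφ hψ hj (hφ.choose_spec.isEnd j) he

theorem isPadded_const (hx₀ : x₀ ∈ A.verts) (N : Fin n → ℕ) :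
    IsPadded A x₀ N fun _ => x₀ :=
  ⟨fun _ => hx₀, fun _ _ _ _ _ => Or.inr rfl, fun _ _ _ _ => hx₀,
    fun _ _ _ _ _ _ _ _ _ => Or.inr rfl, fun _ _ _ _ => rfl, fun _ _ _ => rfl⟩

/-- The class of the constant map. -/
def PadClass.one (n : ℕ) (hx₀ : x₀ ∈ A.verts) : PadClass A x₀ n :=
  PadClass.mk (fun _ => x₀) ⟨0, isPadded_const hx₀ 0⟩

theorem PadClass.one_mul {j : Fin n} (hj : (j : ℕ) ≠ 0) (hx₀ : x₀ ∈ A.verts)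
    (a : PadClass A x₀ n) : PadClass.mul j hj (PadClass.one n hx₀) a = a := by
  induction a using PadClass.ind with
  | _ φ hφ =>
  -- The constant map admits the cut-off `0`, and gluing there returns `φ` itself.
  refine (PadClass.mul_mk hj _ hφ ⟨Even.zero, fun _ _ => rfl⟩).trans
    (PadClass.mk_congr _ _ (funext fun x => ?_))
  obtain ⟨N, hN⟩ := hφ
  unfold glue
  split_ifs with h
  · exact (hN.base_zero x j hj (by omega)).symm
  · simp

theorem PadClass.mul_one {j : Fin n} (hj : (j : ℕ) ≠ 0) (hx₀ : x₀ ∈ A.verts)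
    (a : PadClass A x₀ n) : PadClass.mul j hj a (PadClass.one n hx₀) = a := by
  induction a using PadClass.ind with
  | _ φ hφ =>
  obtain ⟨e, he, -⟩ := exists_common_isEnd hφ hφ j
  refine (PadClass.mul_mk hj hφ _ he).trans (PadClass.mk_congr _ _ (funext fun x => ?_))
  unfold glue
  split_ifs with h
  · rfl
  · exact (he.2 x (by omega)).symm

theorem glue_assoc (j : Fin n) {e d : ℕ} {φ ψ χ : (Fin n → ℕ) → V} :
    glue j (e + d) (glue j e φ ψ) χ = glue j e φ (glue j d ψ χ) := by
  funext x
  simp only [glue, Function.update_self, Function.update_idem]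
  split_ifs <;> first | rfl | omega | simp only [Nat.sub_sub]

theorem PadClass.mul_assoc {j : Fin n} (hj : (j : ℕ) ≠ 0) (a b c : PadClass A x₀ n) :
    PadClass.mul j hj (PadClass.mul j hj a b) c = PadClass.mul j hj a (PadClass.mul j hj b c) := by
  induction a using PadClass.ind with
  | _ φ hφ =>
  induction b using PadClass.ind with
  | _ ψ hψ =>
  induction c using PadClass.ind with
  | _ χ hχ =>
  obtain ⟨e, he, -⟩ := exists_common_isEnd hφ hφ j
  obtain ⟨d, hd, -⟩ := exists_common_isEnd hψ hψ j
  have hed : IsEnd x₀ j (e + d) (glue j e φ ψ) := by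
    refine ⟨he.1.add hd.1, fun x hx => ?_⟩
    unfold glue
    split_ifs
    · exact he.2 x (by omega)
    · exact hd.2 _ (by simp; omega)
  rw [PadClass.mul_mk hj hφ hψ he, PadClass.mul_mk hj hψ hχ hd, PadClass.mul_mk hj _ hχ hed,
    PadClass.mul_mk hj hφ _ he]
  exact PadClass.mk_congr _ _ (glue_assoc j)

/-! ### Inverses -/

/-- The walk to `e` and back, cut off at height `t`. -/
def foldLine (e t a : ℕ) : ℕ := min (min a (2 * e - a)) t

theorem isLineMap_foldLine (e t : ℕ) : IsLineMap (foldLine e t) := by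
  refine IsLineMap.of_succ fun a => ?_
  unfold foldLine
  rw [Nat.even_iff, Nat.even_iff]
  omega

/-- Where the two walks differ, one is at `t` and the other at `t + 1`, so all arrows between them
point the same way. -/
theorem stdStep_foldLine (e t : ℕ) :
    (∀ a, StdStep (foldLine e t a) (foldLine e (t + 1) a) ∨
      foldLine e t a = foldLine e (t + 1) a) ∨
    ∀ a, StdStep (foldLine e (t + 1) a) (foldLine e t a) ∨
      foldLine e (t + 1) a = foldLine e t a := by
  simp only [StdStep, Nat.even_iff, Nat.odd_iff]
  rcases Nat.mod_two_eq_zero_or_one t with h | h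
  · left; intro a; unfold foldLine; omega
  · right; intro a; unfold foldLine; omega

theorem PadClass.exists_mul_eq_one {j : Fin n} (hj : (j : ℕ) ≠ 0) (hx₀ : x₀ ∈ A.verts)
    (a : PadClass A x₀ n) : ∃ b, PadClass.mul j hj a b = PadClass.one n hx₀ := by
  induction a using PadClass.ind with
  | _ φ hφ =>
  obtain ⟨e, he, -⟩ := exists_common_isEnd hφ hφ j
  obtain ⟨N, hN⟩ := id hφ
  have hN' : IsPadded A x₀ (Function.update N j e) φ := hN.of_base_last fun x k hk => by
    by_cases hkj : k = j
    · subst hkj; exact he.2 x (by simpa using hk)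
    · exact hN.base_last x k (by simpa [hkj] using hk)
  -- Reversal respects the arrows because `e` is even; truncated subtraction makes it stay at `0`
  -- beyond `e`.
  have hrev : IsLineMap fun a => e - a := IsLineMap.of_succ fun a => by
    have := Nat.even_iff.1 he.1
    rw [Nat.even_iff, Nat.even_iff]
    omega
  have hψ : ∃ S, IsPadded A x₀ S (reparam j (fun a => e - a) φ) :=
    ⟨_, hN'.reparam j hrev (Or.inr ⟨hj, by simp⟩) e fun a ha => Or.inr ⟨hj, by omega⟩⟩
  have hfold : ∀ t, ∃ S, IsPadded A x₀ S (reparam j (foldLine e t) φ) := fun t =>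
    ⟨_, hN.reparam j (isLineMap_foldLine e t) (Or.inl (by simp [foldLine])) (2 * e)
      fun a ha => Or.inr ⟨hj, by unfold foldLine; omega⟩⟩
  have hcut : ∀ t, PadClass.mk (reparam j (foldLine e t) φ) (hfold t) =
      PadClass.one n hx₀ := by
    intro t
    induction t with
    | zero =>
      exact PadClass.mk_congr _ _ (funext fun x => hN.base_zero _ j hj (by simp [foldLine]))
    | succ t ih =>
      have h0 : foldLine e t 0 = foldLine e (t + 1) 0 := by simp [foldLine]
      rw [← ih]
      rcases stdStep_foldLine e t with h | h
      · exact (PadClass.sound _ _ (hN.reparam_homotopic j h0 h)).symm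
      · exact PadClass.sound _ _ (hN.reparam_homotopic j h0.symm h)
  -- Gluing `φ` to its reverse is `φ` composed with the uncut walk `foldLine e e`, which `hcut`
  -- contracts.
  refine ⟨PadClass.mk _ hψ, (PadClass.mul_mk hj hφ hψ he).trans
    ((PadClass.mk_congr _ (hfold e) (funext fun x => ?_)).trans (hcut e))⟩
  simp only [glue, reparam, Function.update_self, Function.update_idem]
  split_ifs with h
  · have hp : foldLine e e (x j) = x j := by unfold foldLine; omega
    rw [hp, Function.update_eq_self]
  · have hp : foldLine e e (x j) = e - (x j - e) := by unfold foldLine; omega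
    rw [hp]

/-! ### Interchange and the Eckmann–Hilton argument -/

theorem glue_interchange {j k : Fin n} (hjk : j ≠ k) (e d : ℕ) (φ ψ χ ω : (Fin n → ℕ) → V) :
    glue j e (glue k d φ ψ) (glue k d χ ω) = glue k d (glue j e φ χ) (glue j e ψ ω) := by
  funext x
  simp only [glue, Function.update_of_ne hjk, Function.update_of_ne hjk.symm]
  split_ifs
  · rfl
  · rfl
  · rfl
  · rw [Function.update_comm hjk]

theorem IsEnd.glue {φ ψ : (Fin n → ℕ) → V} {j k : Fin n} (hjk : j ≠ k) {e : ℕ}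
    (hφ : IsEnd x₀ j e φ) (hψ : IsEnd x₀ j e ψ) (d : ℕ) :
    IsEnd x₀ j e (glue k d φ ψ) := by
  refine ⟨hφ.1, fun x hx => ?_⟩
  unfold DigraphHomotopy.glue
  split_ifs
  · exact hφ.2 x hx
  · exact hψ.2 _ (by simpa [hjk] using hx)

/-- Once the cut-offs agree across each direction, cutting along `j` and along `k` are independent
case distinctions, and both sides are the same function. -/
theorem PadClass.mul_mul_mul_comm {j k : Fin n} (hj : (j : ℕ) ≠ 0) (hk : (k : ℕ) ≠ 0)
    (hjk : j ≠ k) (a b c d : PadClass A x₀ n) :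
    PadClass.mul j hj (PadClass.mul k hk a b) (PadClass.mul k hk c d) =
      PadClass.mul k hk (PadClass.mul j hj a c) (PadClass.mul j hj b d) := by
  induction a using PadClass.ind with
  | _ φ hφ =>
  induction b using PadClass.ind with
  | _ ψ hψ =>
  induction c using PadClass.ind with
  | _ χ hχ =>
  induction d using PadClass.ind with
  | _ ω hω =>
  obtain ⟨e, he, he'⟩ := exists_common_isEnd hφ hψ j
  obtain ⟨d, hd, hd'⟩ := exists_common_isEnd hφ hχ k
  rw [PadClass.mul_mk hk hφ hψ hd, PadClass.mul_mk hk hχ hω hd', PadClass.mul_mk hj hφ hχ he,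
    PadClass.mul_mk hj hψ hω he', PadClass.mul_mk hj _ _ (he.glue hjk he' d),
    PadClass.mul_mk hk _ _ (hd.glue hjk.symm hd' e)]
  exact PadClass.mk_congr _ _ (glue_interchange hjk e d φ ψ χ ω)

theorem PadClass.isUnital_mul {j : Fin n} (hj : (j : ℕ) ≠ 0) (hx₀ : x₀ ∈ A.verts) :
    EckmannHilton.IsUnital (PadClass.mul (A := A) j hj) (PadClass.one n hx₀) :=
  { left_id := PadClass.one_mul hj hx₀, right_id := PadClass.mul_one hj hx₀ }

theorem PadClass.mul_eq_mul {j k : Fin n} (hj : (j : ℕ) ≠ 0) (hk : (k : ℕ) ≠ 0)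
    (hx₀ : x₀ ∈ A.verts) :
    PadClass.mul (A := A) (x₀ := x₀) j hj = PadClass.mul k hk := by
  by_cases hjk : j = k
  · subst hjk; rfl
  · exact EckmannHilton.mul (PadClass.isUnital_mul hj hx₀) (PadClass.isUnital_mul hk hx₀)
      (PadClass.mul_mul_mul_comm hj hk hjk)

theorem PadClass.mul_comm {j k : Fin n} (hj : (j : ℕ) ≠ 0) (hk : (k : ℕ) ≠ 0) (hjk : j ≠ k)
    (hx₀ : x₀ ∈ A.verts) (a b : PadClass A x₀ n) :
    PadClass.mul j hj a b = PadClass.mul j hj b a :=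
  (EckmannHilton.mul_comm (PadClass.isUnital_mul hk hx₀) (PadClass.isUnital_mul hj hx₀)
    (PadClass.mul_mul_mul_comm hk hj hjk.symm)).comm a b

/-- Concatenation along coordinate `j` makes the classes into a group. -/
noncomputable abbrev PadClass.group (j : Fin n) (hj : (j : ℕ) ≠ 0) (hx₀ : x₀ ∈ A.verts) :
    Group (PadClass A x₀ n) :=
  letI : Mul (PadClass A x₀ n) := ⟨PadClass.mul j hj⟩
  letI : Inv (PadClass A x₀ n) := ⟨fun a => (PadClass.exists_mul_eq_one hj hx₀ a).choose⟩
  letI : One (PadClass A x₀ n) := ⟨PadClass.one n hx₀⟩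
  Group.ofRightAxioms (PadClass.mul_assoc hj) (PadClass.mul_one hj hx₀)
    fun a => (PadClass.exists_mul_eq_one hj hx₀ a).choose_spec

theorem PadClass.mk_concat {M L : Fin n → ℕ} (j : Fin n) (hj : (j : ℕ) ≠ 0)
    (f : TripleGridMap A x₀ M) (g : TripleGridMap A x₀ L) :
    PadClass.mk (concat j hj f g).pad (concat j hj f g).exists_isPadded =
      PadClass.mul j hj (PadClass.mk f.pad f.exists_isPadded)
        (PadClass.mk g.pad g.exists_isPadded) := by
  rw [PadClass.mul_mk hj _ _ (isEnd_evenCeil f j)]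
  refine PadClass.mk_congr _ _ ?_
  rw [glue_eq_concatFun j hj]
  exact (concatFun_isPadded j hj f g).pad_restrict

end Padded

end DigraphHomotopy

/-! ### Transport of the group structure to the relative homotopy set -/

theorem theorem3p1 {V : Type*} (G : Digraph V) (A : DigraphHomotopy.Subdigraph G) (x₀ : V)
    (hx₀ : x₀ ∈ A.verts) (n : ℕ) (hn : 2 ≤ n) :
    ∃ group : Group (DigraphHomotopy.RelHomotopy A x₀ n),
      (∀ (j : Fin n) (hj : (j : ℕ) ≠ 0) (M L : Fin n → ℕ)
        (f : DigraphHomotopy.TripleGridMap A x₀ M) (g : DigraphHomotopy.TripleGridMap A x₀ L),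
        DigraphHomotopy.RelHomotopy.mk f * DigraphHomotopy.RelHomotopy.mk g =
          DigraphHomotopy.RelHomotopy.mk (DigraphHomotopy.concat j hj f g)) ∧
      (3 ≤ n → ∀ a b : DigraphHomotopy.RelHomotopy A x₀ n, a * b = b * a) := by
  have h1 : ((⟨1, hn⟩ : Fin n) : ℕ) ≠ 0 := one_ne_zero
  let _ : Group (DigraphHomotopy.PadClass A x₀ n) := DigraphHomotopy.PadClass.group ⟨1, hn⟩ h1 hx₀
  let inst : Group (DigraphHomotopy.RelHomotopy A x₀ n) :=
    (DigraphHomotopy.relHomotopyEquiv A x₀ n).group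
  have hmul : ∀ a b, DigraphHomotopy.relHomotopyEquiv A x₀ n (a * b) =
      DigraphHomotopy.PadClass.mul ⟨1, hn⟩ h1 (DigraphHomotopy.relHomotopyEquiv A x₀ n a)
        (DigraphHomotopy.relHomotopyEquiv A x₀ n b) := fun a b =>
    (DigraphHomotopy.relHomotopyEquiv A x₀ n).apply_symm_apply _
  refine ⟨inst, fun j hj M L f g => ?_, fun h3 a b => ?_⟩
  · apply (DigraphHomotopy.relHomotopyEquiv A x₀ n).injective
    -- The group was built from the coordinate with index `1`; Eckmann–Hilton lets any admissible
    -- `j` replace it.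
    rw [hmul, DigraphHomotopy.PadClass.mul_eq_mul h1 hj hx₀]
    exact (DigraphHomotopy.PadClass.mk_concat j hj f g).symm
  · apply (DigraphHomotopy.relHomotopyEquiv A x₀ n).injective
    rw [hmul, hmul]
    -- For `3 ≤ n` the index `2` supplies the second direction of concatenation.
    exact DigraphHomotopy.PadClass.mul_comm h1 (k := ⟨2, h3⟩) two_ne_zero (by simp) hx₀ _ _
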